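/- A binary linear code of length $n$ is a subspace $C\subseteq\mathbb F_2^n$; its dual is $C^\perp=\{y\in\mathbb F_2^n : \sum_i x_iy_i=0 \text{ for all } x\in C\}$, and the weight of a vector is the number of its nonzero coordinates. The code $C$ is of Type I if $C=C^\perp$ and not all weights of codewords of $C$ are divisible by $4$; it is even formally self-dual if all its weights are even and, for every $w$, $C$ and $C^\perp$ have the same number of codewords of weight $w$. A Type I or even formally self-dual code of length $n$ is near-extremal if its minimum distance (the least weight of a nonzero codeword) exists and equals $2\lfloor n/8\rfloor$. For a code $C$ and an integer $w\ge 0$, let $C_w$ denote the set of supports $\{i : x_i\neq 0\}$ of the codewords $x\in C$ of weight $w$. A finite multiset of subsets (blocks) of $\{1,\dots,n\}$, all of the same size, is a $1$-design if every point of $\{1,\dots,n\}$ lies in the same number of blocks, counted with multiplicity (this number may be $0$). Let $n\equiv 0\pmod 8$. (1) If $C$ is a near-extremal Type I code of length $n$, then $C_w$ is a $1$-design for every $w$. (2) If $C'$ is a near-extremal even formally self-dual code of length $n$, then $C'_w\cup C'^{\perp}_w$ is a $1$-design for every $w$, where the union is taken as multisets, i.e. a block belonging to both $C'_w$ and $C'^{\perp}_w$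 is counted twice. -/

import Mathlib

namespace BinaryCode

/-- A binary linear code of length `n`: a subspace of `𝔽₂ⁿ`. -/
abbrev Code (n : ℕ) := Submodule (ZMod 2) (Fin n → ZMod 2)

/-- The dual code with respect to the inner product `(x, y) = ∑ i, x i * y i`. -/
def dual {n : ℕ} (C : Code n) : Code n where
  carrier := {y | ∀ x ∈ C, ∑ i, x i * y i = 0}
  add_mem' := by
    intro a b ha hb x hx
    simp only [Pi.add_apply, mul_add, Finset.sum_add_distrib, ha x hx, hb x hx, add_zero]
  zero_mem' := by
    intro x _
    simp
  smul_mem' := by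
    intro r a ha x hx
    simp only [Pi.smul_apply, smul_eq_mul, mul_left_comm _ r, ← Finset.mul_sum, ha x hx, mul_zero]

/-- The support of a vector. The weight of `x` is `hammingNorm x`. -/
def supp {n : ℕ} (x : Fin n → ZMod 2) : Finset (Fin n) :=
  Finset.univ.filter fun i => x i ≠ 0

/-- All weights are even. -/
def IsEven {n : ℕ} (C : Code n) : Prop :=
  ∀ x ∈ C, 2 ∣ hammingNorm x

/-- All weights are divisible by four. -/
def IsDoublyEven {n : ℕ} (C : Code n) : Prop :=
  ∀ x ∈ C, 4 ∣ hammingNorm x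

def IsSelfDual {n : ℕ} (C : Code n) : Prop :=
  C = dual C

/-- Type I: self-dual and not doubly even. -/
def IsTypeI {n : ℕ} (C : Code n) : Prop :=
  IsSelfDual C ∧ ¬ IsDoublyEven C

/-- The number of codewords of weight `w`. -/
noncomputable def weightCount {n : ℕ} (C : Code n) (w : ℕ) : ℕ :=
  {x : Fin n → ZMod 2 | x ∈ C ∧ hammingNorm x = w}.ncard

/-- Even formally self-dual: even, with the same weight distribution as the dual code. -/
def IsEvenFormallySelfDual {n : ℕ} (C : Code n) : Prop :=
  IsEven C ∧ ∀ w, weightCount C w = weightCount (dual C) w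

/-- `d` is the minimum distance: the least weight of a nonzero codeword (in particular, there is
a nonzero codeword). -/
def HasMinDist {n : ℕ} (C : Code n) (d : ℕ) : Prop :=
  IsLeast {w | ∃ x ∈ C, x ≠ 0 ∧ hammingNorm x = w} d

/-- The minimum distance equals `2 ⌊n / 8⌋`. -/
def IsNearExtremal {n : ℕ} (C : Code n) : Prop :=
  HasMinDist C (2 * (n / 8))

open Classical in
/-- The blocks of the support design `C_w`: the supports of the codewords of weight `w`. -/
noncomputable def supportBlocks {n : ℕ} (C : Code n) (w : ℕ) : Finset (Finset (Fin n)) :=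
  (Finset.univ.filter fun x : Fin n → ZMod 2 => x ∈ C ∧ hammingNorm x = w).image supp

open Classical in
/-- A `t`-`(v, k, l)` design on the point set `X`, `v = |X|`. The blocks form a multiset, so
repeated blocks are allowed and counted with multiplicity. -/
def IsDesignWith {X : Type*} [Fintype X] (t v k l : ℕ) (B : Multiset (Finset X)) : Prop :=
  Fintype.card X = v ∧ (∀ b ∈ B, b.card = k) ∧
    ∀ T : Finset X, T.card = t → B.countP (fun b => T ⊆ b) = l

/-- A `t`-design, for some parameters. -/
def IsDesign {X : Type*} [Fintype X] (t : ℕ) (B : Multiset (Finset X)) : Prop :=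
  ∃ v k l : ℕ, IsDesignWith t v k l B

end BinaryCode

namespace BinaryCode

/-! Fix two points `i`, `j` and weight each codeword `c` of `E` by `cᵢ - cⱼ`, a discrete harmonic
function of degree one. The sum of these weights over the words of weight `w` is the difference
between the numbers of blocks of `E_w` through `i` and through `j`. Let `D w` be this difference for
`E` plus that for `E^⊥`; the task is to show `D = 0`.

With `n = 8m`, evenness, formal duality and the presence of the all-one word in both codes confine
`D` to `[2m, 6m]`. The harmonic MacWilliams identity (`macWilliams_harmonicEnumerator`) then forces
`P = ∑ D w X^w` to be `X^(2m) (1 - X²)^(2m-1) q` with `deg q ≤ 2`. Evenness and complementation give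
`q = D(2m) (1 + X²)`. The identity sends `P` to a negative multiple of itself at the fixed point `√2
- 1` of `t ↦ (1 - t)/(1 + t)`, so `P` vanishes there and `D(2m) = 0`
(`eq_zero_of_transform_eq_neg`). A self-dual code is the case `E = E^⊥`, where `D` is twice the
difference for `E`. -/

open Classical in
/-- The codewords of `C`, as a finset. -/
noncomputable def words {n : ℕ} (C : Code n) : Finset (Fin n → ZMod 2) :=
  Finset.univ.filter (· ∈ C)

theorem mem_words {n : ℕ} {C : Code n} {x : Fin n → ZMod 2} : x ∈ words C ↔ x ∈ C := by
  simp [words]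

theorem dual_dual {n : ℕ} (C : Code n) : dual (dual C) = C := by
  let B : LinearMap.BilinForm (ZMod 2) (Fin n → ZMod 2) := dotProductBilin (ZMod 2) (ZMod 2)
  have hB : ∀ x y, B x y = ∑ i, x i * y i := fun x y => rfl
  have hrefl : B.IsRefl := fun x y h => by
    rw [hB] at h ⊢
    simpa only [mul_comm] using h
  have hnd : B.Nondegenerate := by
    refine (hrefl.nondegenerate_iff_separatingLeft).2 fun x hx => ?_
    ext i
    simpa [hB, Pi.single_apply] using hx (Pi.single i 1)
  have hdual : ∀ E : Code n, dual E = B.orthogonal E := fun E => rfl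
  rw [hdual, hdual, LinearMap.BilinForm.orthogonal_orthogonal hnd hrefl]

/-! ### Poisson summation and the harmonic MacWilliams identity. -/

section MacWilliams

variable {R : Type*} [CommRing R]

/-- The nontrivial sign character of `𝔽₂`. -/
def sign (R : Type*) [CommRing R] (a : ZMod 2) : R := if a = 0 then 1 else -1

theorem sign_add (a b : ZMod 2) : sign R (a + b) = sign R a * sign R b := by
  have h : ∀ a : ZMod 2, a = 0 ∨ a = 1 := by decide
  have h2 : (1 : ZMod 2) + 1 = 0 := by decide
  rcases h a with rfl | rfl <;> rcases h b with rfl | rfl <;> simp [sign, h2]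

theorem sign_sum {ι : Type*} (s : Finset ι) (f : ι → ZMod 2) :
    sign R (∑ i ∈ s, f i) = ∏ i ∈ s, sign R (f i) := by
  classical
  induction s using Finset.induction_on with
  | empty => simp [sign]
  | insert i s hi ih => rw [Finset.sum_insert hi, Finset.prod_insert hi, sign_add, ih]

theorem sum_sign_eq_card {n : ℕ} {C : Code n} {v : Fin n → ZMod 2} (hv : v ∈ dual C) :
    ∑ c ∈ words C, sign R (∑ k, c k * v k) = (words C).card := by
  rw [Finset.sum_congr rfl fun c hc => by rw [hv c (mem_words.1 hc)]]
  simp [sign]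

theorem sum_sign_eq_zero {n : ℕ} {C : Code n} {v : Fin n → ZMod 2} (hv : v ∉ dual C) :
    ∑ c ∈ words C, sign R (∑ k, c k * v k) = 0 := by
  obtain ⟨x, hx, hxv⟩ : ∃ x ∈ C, ∑ k, x k * v k ≠ 0 := by
    by_contra! h
    exact hv h
  have hxx : x + x = 0 := by
    ext k
    exact CharTwo.add_self_eq_zero (x k)
  -- Translation by `x` pairs codewords with opposite signs.
  refine Finset.sum_involution (fun c _ => c + x) (fun c _ => ?_) (fun c _ _ h => ?_)
    (fun c hc => mem_words.2 (C.add_mem (mem_words.1 hc) hx)) (fun c _ => ?_)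
  · simp only [Pi.add_apply, add_mul, Finset.sum_add_distrib, sign_add]
    rw [show sign R (∑ k, x k * v k) = -1 from if_neg hxv]
    ring
  · rw [add_eq_left] at h
    simp [h] at hxv
  · rw [add_assoc, hxx, add_zero]

/-- Poisson summation for a product function on `𝔽₂ⁿ`. -/
theorem poisson_summation {n : ℕ} (C : Code n) (g : Fin n → ZMod 2 → R) :
    ∑ c ∈ words C, ∏ k, (g k 0 + sign R (c k) * g k 1) =
      (words C).card * ∑ v ∈ words (dual C), ∏ k, g k (v k) := by
  have h1 : ∀ c : Fin n → ZMod 2, ∏ k, (g k 0 + sign R (c k) * g k 1) =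
      ∑ v : Fin n → ZMod 2, sign R (∑ k, c k * v k) * ∏ k, g k (v k) := by
    intro c
    -- Each factor is a Fourier transform on `𝔽₂`; expanding the product gives the transform on
    -- `𝔽₂ⁿ`.
    have h2 : ∀ k, g k 0 + sign R (c k) * g k 1 = ∑ a : ZMod 2, sign R (c k * a) * g k a := by
      intro k
      rw [show (Finset.univ : Finset (ZMod 2)) = {0, 1} from rfl, Finset.sum_pair (by decide)]
      simp [sign]
    simp_rw [h2, Finset.prod_univ_sum, Fintype.piFinset_univ, Finset.prod_mul_distrib, sign_sum]
  simp_rw [h1]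
  rw [Finset.sum_comm]
  simp_rw [← Finset.sum_mul]
  rw [Finset.mul_sum, ← Finset.sum_subset (Finset.subset_univ (words (dual C)))]
  · exact Finset.sum_congr rfl fun v hv => by rw [sum_sign_eq_card (mem_words.1 hv)]
  · intro v _ hv
    rw [sum_sign_eq_zero (fun h => hv (mem_words.2 h)), zero_mul]

/-- The indicator of the support of `c`. -/
def ind (R : Type*) [CommRing R] {n : ℕ} (c : Fin n → ZMod 2) (i : Fin n) : R :=
  if c i = 0 then 0 else 1

/-- The weight enumerator of `C`, each codeword being counted with the harmonic coefficient
`cᵢ - cⱼ`. -/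
noncomputable def harmonicEnumerator {n : ℕ} (C : Code n) (i j : Fin n) (x y : R) : R :=
  ∑ c ∈ words C, (ind R c i - ind R c j) * (x ^ (n - hammingNorm c) * y ^ hammingNorm c)

theorem prod_ite_eq_zero {n : ℕ} (c : Fin n → ZMod 2) (x y : R) :
    ∏ k, (if c k = 0 then x else y) = x ^ (n - hammingNorm c) * y ^ hammingNorm c := by
  rw [Finset.prod_ite, Finset.prod_const, Finset.prod_const]
  have h := Finset.card_filter_add_card_filter_not (s := Finset.univ) (fun k => c k = 0)
  rw [Finset.card_univ, Fintype.card_fin] at h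
  congr 2
  simp only [hammingNorm]
  exact Nat.eq_sub_of_add_eq h

/-- Twisting coordinate `i` by the sign character swaps `x + y` and `x - y` in the `i`-th factor of
the transform. The extra factor `(x + y) * (x - y)` restores the untwisted product without division,
leaving the square of the swapped factor; subtracting the case `j` turns these squares into `±4xy`.
-/
theorem twisted_poisson_summation {n : ℕ} (C : Code n) (i : Fin n) (x y : R) :
    ∑ c ∈ words C, (if c i = 0 then (x - y) ^ 2 else (x + y) ^ 2) *
        ((x + y) ^ (n - hammingNorm c) * (x - y) ^ hammingNorm c) =
      (x + y) * (x - y) * ((words C).card * ∑ v ∈ words (dual C),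
        sign R (v i) * (x ^ (n - hammingNorm v) * y ^ hammingNorm v)) := by
  have h := poisson_summation C
    (fun k a => (if k = i then sign R a else 1) * if a = 0 then x else y)
  simp_rw [Finset.prod_mul_distrib, prod_ite_eq_zero, Finset.prod_ite_eq' Finset.univ i,
    Finset.mem_univ, if_true] at h
  rw [← h, Finset.mul_sum]
  refine Finset.sum_congr rfl fun c _ => ?_
  rw [← prod_ite_eq_zero, ← Finset.mul_prod_erase _ _ (Finset.mem_univ i),
    ← Finset.mul_prod_erase _ (fun k => _ + _) (Finset.mem_univ i)]
  have h1 : ∏ k ∈ Finset.univ.erase i, (if c k = 0 then x + y else x - y) =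
      ∏ k ∈ Finset.univ.erase i, ((if k = i then sign R 0 else 1) * x +
        sign R (c k) * ((if k = i then sign R 1 else 1) * if (1 : ZMod 2) = 0 then x else y)) := by
    refine Finset.prod_congr rfl fun k hk => ?_
    rw [if_neg (Finset.ne_of_mem_erase hk), if_neg (Finset.ne_of_mem_erase hk)]
    by_cases hc : c k = 0 <;> simp [hc, sign, sub_eq_add_neg]
  rw [← h1]
  generalize ∏ k ∈ Finset.univ.erase i, (if c k = 0 then x + y else x - y) = p
  by_cases hc : c i = 0 <;> simp [hc, sign] <;> ring

/-- The MacWilliams identity for the harmonic weight enumerator of degree one. -/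
theorem macWilliams_harmonicEnumerator {n : ℕ} (C : Code n) (i j : Fin n) (x y : R) :
    2 * (2 * x * y * harmonicEnumerator C i j (x + y) (x - y)) =
      2 * (-((words C).card * ((x + y) * (x - y)) * harmonicEnumerator (dual C) i j x y)) := by
  have hi := twisted_poisson_summation C i x y
  have hj := twisted_poisson_summation C j x y
  have hl : ∑ c ∈ words C, (if c i = 0 then (x - y) ^ 2 else (x + y) ^ 2) *
        ((x + y) ^ (n - hammingNorm c) * (x - y) ^ hammingNorm c) -
      ∑ c ∈ words C, (if c j = 0 then (x - y) ^ 2 else (x + y) ^ 2) *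
        ((x + y) ^ (n - hammingNorm c) * (x - y) ^ hammingNorm c) =
      2 * (2 * x * y * harmonicEnumerator C i j (x + y) (x - y)) := by
    rw [← Finset.sum_sub_distrib, harmonicEnumerator, Finset.mul_sum, Finset.mul_sum]
    refine Finset.sum_congr rfl fun c _ => ?_
    by_cases h1 : c i = 0 <;> by_cases h2 : c j = 0 <;> simp [h1, h2, ind] <;> ring
  have hr : ∑ v ∈ words (dual C), sign R (v i) * (x ^ (n - hammingNorm v) * y ^ hammingNorm v) -
      ∑ v ∈ words (dual C), sign R (v j) * (x ^ (n - hammingNorm v) * y ^ hammingNorm v) =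
      -(2 * harmonicEnumerator (dual C) i j x y) := by
    rw [← Finset.sum_sub_distrib, harmonicEnumerator, Finset.mul_sum, ← Finset.sum_neg_distrib]
    refine Finset.sum_congr rfl fun c _ => ?_
    by_cases h1 : c i = 0 <;> by_cases h2 : c j = 0 <;> simp [h1, h2, ind, sign] <;> ring
  rw [← hl, hi, hj, ← mul_sub, ← mul_sub, hr]
  ring

end MacWilliams

end BinaryCode

/-! ### The polynomial argument. -/

namespace BinaryCode

-- For `2m ≤ w ≤ 6m` both exponents `8m - w` and `w` are at least `2m`, so `(1 - X²)^(2m)` divides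
-- the transformed sum. The right-hand side carries one factor `1 - X²` of its own, hence the
-- exponent `2m - 1`.
open Polynomial in
theorem one_sub_X_sq_pow_dvd {m : ℕ} {D : ℕ → ℝ} (hlow : ∀ w < 2 * m, D w = 0)
    (hhigh : ∀ w, 6 * m < w → D w = 0) {K : ℝ} (hK : 0 < K)
    (h : 2 * X * ∑ w ∈ Finset.range (8 * m + 1), C (D w) * (1 + X) ^ (8 * m - w) * (1 - X) ^ w =
      -C K * ((1 + X) * (1 - X)) * ∑ w ∈ Finset.range (8 * m + 1), C (D w) * X ^ w) :
    (1 - X ^ 2 : ℝ[X]) ^ (2 * m - 1) ∣ ∑ w ∈ Finset.range (8 * m + 1), C (D w) * X ^ w := by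
  rcases Nat.eq_zero_or_pos m with rfl | hm
  · simp
  have hne : (1 - X ^ 2 : ℝ[X]) ≠ 0 := fun h0 => by
    simpa using congrArg (fun p : ℝ[X] => p.coeff 0) h0
  have hdvd : (1 - X ^ 2 : ℝ[X]) ^ (2 * m) ∣
      ∑ w ∈ Finset.range (8 * m + 1), C (D w) * (1 + X) ^ (8 * m - w) * (1 - X) ^ w := by
    refine Finset.dvd_sum fun w _ => ?_
    by_cases h1 : w < 2 * m
    · simp [hlow w h1]
    by_cases h2 : 6 * m < w
    · simp [hhigh w h2]
    rw [show (1 - X ^ 2 : ℝ[X]) = (1 + X) * (1 - X) by ring, mul_pow, mul_assoc]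
    exact Dvd.dvd.mul_left
      (mul_dvd_mul (pow_dvd_pow _ (by omega)) (pow_dvd_pow _ (by omega))) _
  have h3 := hdvd.mul_left (2 * X)
  rw [h, show (1 - X ^ 2 : ℝ[X]) ^ (2 * m) = (1 - X ^ 2) * (1 - X ^ 2) ^ (2 * m - 1) by
      rw [← pow_succ']; congr 1; omega,
    show ∀ p : ℝ[X], -C K * ((1 + X) * (1 - X)) * p = (1 - X ^ 2) * (C (-K) * p) by
      intro p; rw [C_neg]; ring] at h3
  have h4 := (mul_dvd_mul_iff_left hne).1 h3
  exact (IsUnit.dvd_mul_left (isUnit_C.2 (neg_ne_zero.2 hK.ne').isUnit)).1 h4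

open Polynomial in
theorem eq_zero_of_transform_eq_neg {m : ℕ} (hm : 0 < m) {D : ℕ → ℝ}
    (hlow : ∀ w < 2 * m, D w = 0) (hhigh : ∀ w, 6 * m < w → D w = 0)
    (hodd : D (2 * m + 1) = 0) (hsymm : D (6 * m) = -D (2 * m)) {K : ℝ} (hK : 0 < K)
    (h : 2 * X * ∑ w ∈ Finset.range (8 * m + 1), C (D w) * (1 + X) ^ (8 * m - w) * (1 - X) ^ w =
      -C K * ((1 + X) * (1 - X)) * ∑ w ∈ Finset.range (8 * m + 1), C (D w) * X ^ w) (w : ℕ) :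
    D w = 0 := by
  have hdvd := one_sub_X_sq_pow_dvd hlow hhigh hK h
  set P : ℝ[X] := ∑ w ∈ Finset.range (8 * m + 1), C (D w) * X ^ w with hP
  have hcoeff : ∀ k, P.coeff k = D k := by
    intro k
    simp only [hP, finsetSum_coeff, coeff_C_mul, coeff_X_pow, mul_ite, mul_one, mul_zero,
      Finset.sum_ite_eq, Finset.mem_range]
    split_ifs with hk
    · rfl
    · exact (hhigh k (by omega)).symm
  have hX : (X : ℝ[X]) ^ (2 * m) ∣ P := X_pow_dvd_iff.2 fun d hd => by rw [hcoeff, hlow d hd]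
  have hcop : IsCoprime ((X : ℝ[X]) ^ (2 * m)) ((1 - X ^ 2) ^ (2 * m - 1)) :=
    IsCoprime.pow ⟨X, 1, by ring⟩
  obtain ⟨q, hq⟩ := hcop.mul_dvd hX hdvd
  have hPdeg : P.natDegree ≤ 6 * m :=
    natDegree_le_iff_coeff_eq_zero.2 fun N hN => by rw [hcoeff, hhigh N hN]
  have hB : (1 - X ^ 2 : ℝ[X]).natDegree = 2 := by compute_degree!
  have hqdeg : q.natDegree ≤ 2 := by
    by_cases hq0 : q = 0
    · simp [hq0]
    have hB0 : (1 - X ^ 2 : ℝ[X]) ≠ 0 := fun h0 => by simp [h0] at hB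
    have := congrArg natDegree hq
    rw [natDegree_mul (mul_ne_zero (pow_ne_zero _ X_ne_zero) (pow_ne_zero _ hB0)) hq0,
      natDegree_mul (pow_ne_zero _ X_ne_zero) (pow_ne_zero _ hB0), natDegree_pow, natDegree_pow,
      hB, natDegree_X] at this
    omega
  have hc0 : q.coeff 0 = D (2 * m) := by
    rw [← hcoeff, hq, mul_assoc, coeff_X_pow_mul', if_pos le_rfl, Nat.sub_self, mul_coeff_zero]
    simp [coeff_zero_eq_eval_zero]
  have hc1 : q.coeff 1 = 0 := by
    rw [← hcoeff, hq, mul_assoc, add_comm, coeff_X_pow_mul, mul_coeff_one] at hodd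
    -- Powers of `1 - X²` are congruent to `1` modulo `X²`.
    have h1 : ((1 - X ^ 2 : ℝ[X]) ^ (2 * m - 1)).coeff 1 = 0 := by
      obtain ⟨r, hr⟩ := sub_dvd_pow_sub_pow (1 - X ^ 2 : ℝ[X]) 1 (2 * m - 1)
      rw [one_pow, sub_eq_iff_eq_add] at hr
      rw [hr, show (1 - X ^ 2 - 1 : ℝ[X]) * r = X ^ 2 * (-r) by ring, coeff_add, coeff_X_pow_mul']
      simp [coeff_one]
    rw [h1] at hodd
    simpa [coeff_zero_eq_eval_zero] using hodd
  have hc2 : q.coeff 2 = D (2 * m) := by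
    -- Compare coefficients in the top possible degree `6m = 2m + 2(2m - 1) + 2`; the power of `1 -
    -- X²` contributes `(-1)^(2m-1) = -1`.
    have h1 : D (6 * m) = -q.coeff 2 := by
      rw [← hcoeff, hq, mul_assoc, show 6 * m = ((2 * m - 1) * 2 + 2) + 2 * m by omega,
        coeff_X_pow_mul,
        coeff_mul_add_eq_of_natDegree_le (by rw [natDegree_pow, hB]) hqdeg,
        coeff_pow_of_natDegree_le hB.le]
      have : (1 - X ^ 2 : ℝ[X]).coeff 2 = -1 := by simp [coeff_one]
      rw [this, Odd.neg_one_pow ⟨m - 1, by omega⟩]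
      ring
    linarith
  -- the positive fixed point of `t ↦ (1 - t) / (1 + t)`
  obtain ⟨t, ht0, ht1, ht⟩ : ∃ t : ℝ, 0 < t ∧ t < 1 ∧ 1 - t = (1 + t) * t := by
    have h2 : Real.sqrt 2 ^ 2 = 2 := Real.sq_sqrt (by norm_num)
    have h0 := Real.sqrt_nonneg 2
    exact ⟨Real.sqrt 2 - 1, by nlinarith, by nlinarith, by nlinarith⟩
  -- As `1 - t = (1 + t) t`, the transformed sum at `t` is `(1 + t)^(8m) P(t)`. The two sides are
  -- then multiples of `P(t)` by constants of opposite sign.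
  have hfix : 2 * t * ((1 + t) ^ (8 * m) * P.eval t) = -K * ((1 + t) * (1 - t)) * P.eval t := by
    have h1 := congrArg (eval t) h
    simp only [eval_mul, eval_finsetSum, eval_pow, eval_add, eval_sub, eval_one, eval_X, eval_C,
      eval_neg, eval_ofNat] at h1
    rw [← h1, hP, eval_finsetSum, Finset.mul_sum]
    congr 1
    refine Finset.sum_congr rfl fun w hw => ?_
    rw [ht, mul_pow, eval_mul, eval_C, eval_pow, eval_X]
    have : (1 + t) ^ (8 * m) = (1 + t) ^ (8 * m - w) * (1 + t) ^ w := by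
      rw [← pow_add]; congr 1; have := Finset.mem_range.1 hw; omega
    rw [this]; ring
  have hPt : P.eval t = 0 := by
    have h1 : (2 * t * (1 + t) ^ (8 * m) + K * ((1 + t) * (1 - t))) * P.eval t = 0 := by
      linear_combination hfix
    have : 0 < 1 - t := by linarith
    exact (mul_eq_zero.1 h1).resolve_left (by positivity)
  have hqt : q.eval t = D (2 * m) * (1 + t ^ 2) := by
    rw [eval_eq_sum_range' (n := 3) (by omega)]
    simp only [Finset.sum_range_succ, Finset.sum_range_zero, hc0, hc1, hc2]
    ring
  have hD : D (2 * m) = 0 := by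
    rw [hq, eval_mul, hqt] at hPt
    have h1 : 0 < 1 - t ^ 2 := by nlinarith
    have h2 : eval t ((X : ℝ[X]) ^ (2 * m) * (1 - X ^ 2) ^ (2 * m - 1)) ≠ 0 := by
      simp only [eval_mul, eval_pow, eval_X, eval_sub, eval_one]
      positivity
    have h3 := (mul_eq_zero.1 hPt).resolve_left h2
    exact (mul_eq_zero.1 h3).resolve_right (by positivity)
  have hq0 : q = 0 := by
    ext k
    match k with
    | 0 => simpa using hc0.trans hD
    | 1 => simpa using hc1
    | 2 => simpa using hc2.trans hD
    | k + 3 => simpa using coeff_eq_zero_of_natDegree_lt (by omega)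
  rw [← hcoeff, hq, hq0, mul_zero, coeff_zero]

end BinaryCode

/-! ### Harmonic coefficients of a code and its dual. -/

namespace BinaryCode

/-- The contribution of weight `w` to `harmonicEnumerator C i j`. -/
noncomputable def harmonicCoeff {n : ℕ} (C : Code n) (i j : Fin n) (w : ℕ) : ℝ :=
  ∑ c ∈ (words C).filter (hammingNorm · = w), (ind ℝ c i - ind ℝ c j)

theorem hammingNorm_le {n : ℕ} (c : Fin n → ZMod 2) : hammingNorm c ≤ n := by
  simpa using hammingNorm_le_card_fintype (x := c)

open Polynomial in
theorem harmonicEnumerator_eq_sum {n : ℕ} (E : Code n) (i j : Fin n) (x y : ℝ[X]) :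
    harmonicEnumerator E i j x y =
      ∑ w ∈ Finset.range (n + 1), C (harmonicCoeff E i j w) * x ^ (n - w) * y ^ w := by
  rw [harmonicEnumerator, ← Finset.sum_fiberwise_of_maps_to (s := words E)
    (t := Finset.range (n + 1)) (g := fun c => hammingNorm c)
    (fun c _ => Finset.mem_range.2 (Nat.lt_succ_of_le (hammingNorm_le c)))]
  refine Finset.sum_congr rfl fun w _ => ?_
  rw [harmonicCoeff, map_sum, mul_assoc, Finset.sum_mul]
  refine Finset.sum_congr rfl fun c hc => ?_
  rw [(Finset.mem_filter.1 hc).2]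
  by_cases h1 : c i = 0 <;> by_cases h2 : c j = 0 <;> simp [h1, h2, ind]

theorem harmonicCoeff_eq_zero {n : ℕ} {C : Code n} {i j : Fin n} {w : ℕ}
    (h : ∀ c ∈ C, hammingNorm c = w → (c i = 0 ↔ c j = 0)) : harmonicCoeff C i j w = 0 := by
  refine Finset.sum_eq_zero fun c hc => ?_
  rw [Finset.mem_filter, mem_words] at hc
  simp [ind, h c hc.1 hc.2]

theorem hammingNorm_add_one {n : ℕ} (c : Fin n → ZMod 2) :
    hammingNorm (c + 1) = n - hammingNorm c := by
  have h := Finset.card_filter_add_card_filter_not (s := Finset.univ) (fun k => c k ≠ 0)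
  rw [Finset.card_univ, Fintype.card_fin] at h
  have h1 : ∀ a : ZMod 2, a + 1 ≠ 0 ↔ ¬ a ≠ 0 := by decide
  simp only [hammingNorm, Pi.add_apply, Pi.one_apply, h1]
  omega

theorem add_one_add_one {n : ℕ} (c : Fin n → ZMod 2) : c + 1 + 1 = c := by
  ext k
  have h : ∀ a : ZMod 2, a + 1 + 1 = a := by decide
  exact h (c k)

theorem hammingNorm_eq_iff_eq_one {n : ℕ} {c : Fin n → ZMod 2} : hammingNorm c = n ↔ c = 1 := by
  constructor
  · intro h
    have h1 := hammingNorm_add_one c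
    rw [h, Nat.sub_self, hammingNorm_eq_zero] at h1
    rw [← add_one_add_one c, h1, zero_add]
  · rintro rfl
    simpa using hammingNorm_add_one (0 : Fin n → ZMod 2)

/-- Complementation `c ↦ c + 1` exchanges weights `w` and `n - w` and negates `cᵢ - cⱼ`. -/
theorem harmonicCoeff_sub {n : ℕ} {C : Code n} (h1 : (1 : Fin n → ZMod 2) ∈ C) (i j : Fin n)
    {w : ℕ} (hw : w ≤ n) : harmonicCoeff C i j (n - w) = -harmonicCoeff C i j w := by
  have hmaps : ∀ u ≤ n, ∀ c ∈ (words C).filter (hammingNorm · = u),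
      c + 1 ∈ (words C).filter (hammingNorm · = n - u) := by
    intro u _ c hc
    rw [Finset.mem_filter, mem_words] at hc ⊢
    exact ⟨C.add_mem hc.1 h1, by rw [hammingNorm_add_one, hc.2]⟩
  rw [harmonicCoeff, harmonicCoeff, ← Finset.sum_neg_distrib]
  refine Finset.sum_bij' (fun c _ => c + 1) (fun c _ => c + 1) (fun c hc => ?_) (hmaps w hw)
    (fun c _ => add_one_add_one c) (fun c _ => add_one_add_one c) (fun c _ => ?_)
  · have := hmaps (n - w) (Nat.sub_le _ _) c hc
    rwa [Nat.sub_sub_self hw] at this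
  · have h : ∀ a : ZMod 2, a + 1 = 0 ↔ ¬ a = 0 := by decide
    by_cases h2 : c i = 0 <;> by_cases h3 : c j = 0 <;> simp [h2, h3, ind, h]

theorem harmonicCoeff_eq_zero_of_lt {n d : ℕ} {C : Code n}
    (hd : ∀ x ∈ C, x ≠ 0 → d ≤ hammingNorm x) (i j : Fin n) {w : ℕ} (hw : w < d) :
    harmonicCoeff C i j w = 0 := by
  refine harmonicCoeff_eq_zero fun c hc hcw => ?_
  by_cases h0 : c = 0
  · simp [h0]
  · have := hd c hc h0
    omega

theorem harmonicCoeff_eq_zero_of_gt {n d : ℕ} {C : Code n}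
    (hd : ∀ x ∈ C, x ≠ 0 → d ≤ hammingNorm x) (h1 : (1 : Fin n → ZMod 2) ∈ C) (i j : Fin n)
    {w : ℕ} (hw : n < w + d) : harmonicCoeff C i j w = 0 := by
  by_cases hwn : w ≤ n
  · have := harmonicCoeff_sub h1 i j hwn
    rw [harmonicCoeff_eq_zero_of_lt hd i j (by omega)] at this
    linarith
  · refine harmonicCoeff_eq_zero fun c _ hcw => ?_
    have := hammingNorm_le c
    omega

/-- The harmonic coefficients of a pair of mutually dual even codes of equal size and minimum
distance at least `n / 4` cancel. -/
theorem harmonicCoeff_add_harmonicCoeff_dual_eq_zero {m : ℕ} (hm : 0 < m) {E : Code (8 * m)}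
    (heven : IsEven E) (heven' : IsEven (dual E))
    (hd : ∀ x ∈ E, x ≠ 0 → 2 * m ≤ hammingNorm x)
    (hd' : ∀ x ∈ dual E, x ≠ 0 → 2 * m ≤ hammingNorm x)
    (h1 : (1 : Fin (8 * m) → ZMod 2) ∈ E) (h1' : (1 : Fin (8 * m) → ZMod 2) ∈ dual E)
    (hcard : (words E).card = (words (dual E)).card) (i j : Fin (8 * m)) (w : ℕ) :
    harmonicCoeff E i j w + harmonicCoeff (dual E) i j w = 0 := by
  have hodd : ∀ {F : Code (8 * m)}, IsEven F → harmonicCoeff F i j (2 * m + 1) = 0 := by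
    refine fun hF => harmonicCoeff_eq_zero fun c hc hcw => ?_
    have := hF c hc
    omega
  have hsymm : ∀ {F : Code (8 * m)}, 1 ∈ F →
      harmonicCoeff F i j (6 * m) = -harmonicCoeff F i j (2 * m) := by
    intro F hF
    rw [← harmonicCoeff_sub hF i j (by omega)]
    congr 1
    omega
  refine eq_zero_of_transform_eq_neg hm
    (D := fun w => harmonicCoeff E i j w + harmonicCoeff (dual E) i j w)
    (K := (words E).card) (fun w hw => ?_) (fun w hw => ?_) ?_ ?_ ?_ ?_ w
  · simp only [harmonicCoeff_eq_zero_of_lt hd i j hw, harmonicCoeff_eq_zero_of_lt hd' i j hw,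
      add_zero]
  · have hw' : 8 * m < w + 2 * m := by omega
    simp only [harmonicCoeff_eq_zero_of_gt hd h1 i j hw',
      harmonicCoeff_eq_zero_of_gt hd' h1' i j hw', add_zero]
  · simp only [hodd heven, hodd heven', add_zero]
  · simp only [hsymm h1, hsymm h1']
    ring
  · exact_mod_cast Finset.card_pos.2 ⟨1, mem_words.2 h1⟩
  · have hsum : ∀ x y : Polynomial ℝ, ∑ w ∈ Finset.range (8 * m + 1),
        Polynomial.C (harmonicCoeff E i j w + harmonicCoeff (dual E) i j w) *
          x ^ (8 * m - w) * y ^ w =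
        harmonicEnumerator E i j x y + harmonicEnumerator (dual E) i j x y := by
      intro x y
      rw [harmonicEnumerator_eq_sum, harmonicEnumerator_eq_sum, ← Finset.sum_add_distrib]
      refine Finset.sum_congr rfl fun w _ => ?_
      rw [Polynomial.C_add]
      ring
    have hE := mul_left_cancel₀ two_ne_zero
      (macWilliams_harmonicEnumerator E i j (1 : Polynomial ℝ) Polynomial.X)
    have hE' := mul_left_cancel₀ two_ne_zero
      (macWilliams_harmonicEnumerator (dual E) i j (1 : Polynomial ℝ) Polynomial.X)
    -- The identity exchanges `E` and its dual; equal sizes give both instances the same constant,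
    -- so they add up to an identity for the sum alone.
    rw [dual_dual, ← hcard] at hE'
    have hsum1 := hsum 1 Polynomial.X
    simp only [one_pow, mul_one] at hsum1
    rw [hsum, hsum1, map_natCast]
    linear_combination hE + hE'

/-! ### From harmonic coefficients to block counts. -/

theorem supp_injective {n : ℕ} : Function.Injective (supp (n := n)) := by
  intro x y h
  ext k
  have hk : x k ≠ 0 ↔ y k ≠ 0 := by
    have := congrArg (k ∈ ·) h
    simpa [supp] using this
  have h2 : ∀ a b : ZMod 2, (a ≠ 0 ↔ b ≠ 0) → a = b := by decide
  rw [h2 _ _ hk]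

theorem card_eq_of_mem_supportBlocks {n : ℕ} {C : Code n} {w : ℕ} {b : Finset (Fin n)}
    (hb : b ∈ supportBlocks C w) : b.card = w := by
  classical
  simp only [supportBlocks, Finset.mem_image, Finset.mem_filter] at hb
  obtain ⟨x, ⟨-, -, hx⟩, rfl⟩ := hb
  exact hx

open Classical in
theorem countP_supportBlocks {n : ℕ} (C : Code n) (w : ℕ) (i : Fin n) :
    (supportBlocks C w).val.countP (fun b => {i} ⊆ b) =
      ((words C).filter fun c => hammingNorm c = w ∧ c i ≠ 0).card := by
  rw [Multiset.countP_eq_card_filter, ← Finset.filter_val, Finset.card_val, supportBlocks,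
    Finset.filter_image, Finset.card_image_of_injective _ supp_injective, words,
    Finset.filter_filter, Finset.filter_filter]
  simp [supp, and_assoc]

open Classical in
theorem harmonicCoeff_eq_countP_sub {n : ℕ} (C : Code n) (i j : Fin n) (w : ℕ) :
    harmonicCoeff C i j w = ((supportBlocks C w).val.countP (fun b => {i} ⊆ b) : ℝ) -
      ((supportBlocks C w).val.countP (fun b => {j} ⊆ b) : ℝ) := by
  have h : ∀ k : Fin n, ∑ c ∈ (words C).filter (hammingNorm · = w), ind ℝ c k =
      ((supportBlocks C w).val.countP (fun b => {k} ⊆ b) : ℝ) := by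
    intro k
    rw [countP_supportBlocks, ← Finset.filter_filter, Finset.natCast_card_filter]
    refine Finset.sum_congr rfl fun c _ => ?_
    by_cases hc : c k = 0 <;> simp [ind, hc]
  rw [harmonicCoeff, Finset.sum_sub_distrib, h, h]

theorem weightCount_eq_card {n : ℕ} (C : Code n) (w : ℕ) :
    weightCount C w = ((words C).filter (hammingNorm · = w)).card := by
  rw [weightCount, ← Set.ncard_coe_finset]
  congr 1
  ext x
  simp [mem_words]

theorem weightCount_pos_iff {n : ℕ} {C : Code n} {w : ℕ} :
    0 < weightCount C w ↔ ∃ x ∈ C, hammingNorm x = w := by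
  rw [weightCount_eq_card, Finset.card_pos]
  simp [Finset.Nonempty, mem_words]

theorem card_words_eq_sum_weightCount {n : ℕ} (C : Code n) :
    (words C).card = ∑ w ∈ Finset.range (n + 1), weightCount C w := by
  simp_rw [weightCount_eq_card]
  exact Finset.card_eq_sum_card_fiberwise
    fun c _ => by simpa using Nat.lt_succ_of_le (hammingNorm_le c)

theorem natCast_hammingNorm {n : ℕ} (x : Fin n → ZMod 2) :
    (hammingNorm x : ZMod 2) = ∑ i, x i := by
  rw [hammingNorm, Finset.natCast_card_filter]
  refine Finset.sum_congr rfl fun i _ => ?_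
  have h : ∀ a : ZMod 2, (if a ≠ 0 then 1 else 0) = a := by decide
  exact h (x i)

theorem one_mem_dual {n : ℕ} {C : Code n} (h : IsEven C) : (1 : Fin n → ZMod 2) ∈ dual C := by
  intro x hx
  simpa [natCast_hammingNorm] using (ZMod.natCast_eq_zero_iff _ 2).2 (h x hx)

/-- Since `a * a = a` in `𝔽₂`, the product of `x` with itself is its weight modulo `2`. -/
theorem IsSelfDual.isEvenFormallySelfDual {n : ℕ} {C : Code n} (h : IsSelfDual C) :
    IsEvenFormallySelfDual C := by
  refine ⟨fun x hx => ?_, fun w => by rw [← show C = dual C from h]⟩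
  have hx' : x ∈ dual C := by rwa [← show C = dual C from h]
  have h1 := hx' x hx
  have h2 : ∀ a : ZMod 2, a * a = a := by decide
  simp only [h2] at h1
  rwa [← natCast_hammingNorm, ZMod.natCast_eq_zero_iff] at h1

open Classical in
/-- For a near-extremal even formally self-dual code of length divisible by `8`, all points lie in
the same number of blocks of `C_w ∪ C^⊥_w`. -/
theorem countP_supportBlocks_add_dual {n : ℕ} (hn : n % 8 = 0) {E : Code n}
    (hE : IsEvenFormallySelfDual E) (hE' : IsNearExtremal E) (w : ℕ) (i j : Fin n) :
    (supportBlocks E w).val.countP (fun b => {i} ⊆ b) +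
        (supportBlocks (dual E) w).val.countP (fun b => {i} ⊆ b) =
      (supportBlocks E w).val.countP (fun b => {j} ⊆ b) +
        (supportBlocks (dual E) w).val.countP (fun b => {j} ⊆ b) := by
  obtain ⟨m, rfl⟩ := Nat.dvd_of_mod_eq_zero hn
  have hm : 0 < m := by
    have := i.pos
    omega
  obtain ⟨heven, hcount⟩ := hE
  have htransfer : ∀ x ∈ dual E, ∃ y ∈ E, hammingNorm y = hammingNorm x := fun x hx =>
    weightCount_pos_iff.1 (by rw [hcount]; exact weightCount_pos_iff.2 ⟨x, hx, rfl⟩)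
  have hd : ∀ x ∈ E, x ≠ 0 → 2 * m ≤ hammingNorm x := by
    intro x hx hx0
    have := hE'.2 ⟨x, hx, hx0, rfl⟩
    rwa [Nat.mul_div_cancel_left m (by norm_num)] at this
  have h1' := one_mem_dual heven
  -- Equal weight distributions give `E` a word of weight `n`, which can only be the all-one word.
  obtain ⟨y, hy, hyn⟩ := htransfer 1 h1'
  rw [hammingNorm_eq_iff_eq_one.2 rfl, hammingNorm_eq_iff_eq_one] at hyn
  have key := harmonicCoeff_add_harmonicCoeff_dual_eq_zero hm heven
    (fun x hx => by
      obtain ⟨z, hz, hzx⟩ := htransfer x hx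
      exact hzx ▸ heven z hz)
    hd
    (fun x hx hx0 => by
      obtain ⟨z, hz, hzx⟩ := htransfer x hx
      refine hzx ▸ hd z hz fun hz0 => hx0 ?_
      rwa [hz0, hammingNorm_zero, eq_comm, hammingNorm_eq_zero] at hzx)
    (hyn ▸ hy) h1'
    (by simp_rw [card_words_eq_sum_weightCount, hcount]) i j w
  rw [harmonicCoeff_eq_countP_sub, harmonicCoeff_eq_countP_sub] at key
  have : ((supportBlocks E w).val.countP (fun b => {i} ⊆ b) : ℝ) +
        ((supportBlocks (dual E) w).val.countP (fun b => {i} ⊆ b) : ℝ) =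
      ((supportBlocks E w).val.countP (fun b => {j} ⊆ b) : ℝ) +
        ((supportBlocks (dual E) w).val.countP (fun b => {j} ⊆ b) : ℝ) := by linarith
  exact_mod_cast this

theorem IsNearExtremal.length_pos {n : ℕ} {C : Code n} (h : IsNearExtremal C) : 0 < n := by
  obtain ⟨x, -, hx0, -⟩ := h.1
  exact (hammingNorm_pos_iff.2 hx0).trans_le (hammingNorm_le x)

open Classical in
theorem isDesign_one_of_countP_eq {n : ℕ} (hn : 0 < n) {B : Multiset (Finset (Fin n))} (w : ℕ)
    (hcard : ∀ b ∈ B, b.card = w)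
    (h : ∀ i j : Fin n, B.countP (fun b => {i} ⊆ b) = B.countP (fun b => {j} ⊆ b)) :
    IsDesign 1 B := by
  refine ⟨n, w, B.countP (fun b => {(⟨0, hn⟩ : Fin n)} ⊆ b), Fintype.card_fin n, hcard, ?_⟩
  intro T hT
  obtain ⟨i, rfl⟩ := Finset.card_eq_one.1 hT
  convert h i ⟨0, hn⟩

end BinaryCode

/-- The union of the two support designs is the sum of multisets: a block that lies in both is
counted twice. -/
theorem theorem1p1 (n : ℕ) (hn : n % 8 = 0) :
    (∀ C : BinaryCode.Code n, BinaryCode.IsTypeI C → BinaryCode.IsNearExtremal C →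
      ∀ w : ℕ, BinaryCode.IsDesign 1 (BinaryCode.supportBlocks C w).val) ∧
    (∀ C' : BinaryCode.Code n, BinaryCode.IsEvenFormallySelfDual C' →
      BinaryCode.IsNearExtremal C' →
      ∀ w : ℕ, BinaryCode.IsDesign 1
        ((BinaryCode.supportBlocks C' w).val +
          (BinaryCode.supportBlocks (BinaryCode.dual C') w).val)) := by
  refine ⟨fun C hC hC' w => ?_, fun C hC hC' w => ?_⟩
  · refine BinaryCode.isDesign_one_of_countP_eq hC'.length_pos w
      (fun b hb => BinaryCode.card_eq_of_mem_supportBlocks hb) fun i j => ?_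
    -- With `C = C^⊥` each count appears twice, and halving gives the claim.
    have h := BinaryCode.countP_supportBlocks_add_dual hn hC.1.isEvenFormallySelfDual hC' w i j
    rw [← show C = BinaryCode.dual C from hC.1] at h
    omega
  · refine BinaryCode.isDesign_one_of_countP_eq hC'.length_pos w (fun b hb => ?_) fun i j => ?_
    · rcases Multiset.mem_add.1 hb with hb | hb
      · exact BinaryCode.card_eq_of_mem_supportBlocks hb
      · exact BinaryCode.card_eq_of_mem_supportBlocks hb
    · rw [Multiset.countP_add, Multiset.countP_add]
      exact BinaryCode.countP_supportBlocks_add_dual hn hC hC' w i j
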